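/- **Definitions.** An *Esakia space* is a compact topological space $Y$ with a partial order such that (a) whenever $x\not\leq y$ there is a clopen up-set containing $x$ but not $y$, and (b) the down-set of every clopen set is clopen. An *Esakia morphism* is a continuous monotone map $f$ such that $f(x)\le y$ implies $y=f(z)$ for some $z\ge x$. Let $\mathbf{ESA}$ be the category of nonempty Esakia spaces and Esakia morphisms, and $\mathbf{HA}$ the category of nontrivial ($\mathbf 0\neq\mathbf 1$) Heyting algebras and Heyting homomorphisms. For a Heyting algebra $A$, $Hom(A,\{0,1\})$ is the set of bounded lattice homomorphisms $A\to\{0,1\}$, ordered pointwise. An *I-topological system* is a triple $(X,\models,A)$ of a nonempty set $X$, a Heyting algebra $A$ and a relation $\models$ from $X$ to $A$ such that, for all $x\in X$ and $a,b\in A$: $x\not\models\mathbf 0$; $x\models a\wedge b$ iff $x\models a$ and $x\models b$; $x\models a\vee b$ iff $x\models a$ or $x\models b$; and $x\models a\to b$ iff for every $y\in X$ with $p^*(x)\le p^*(y)$ one has $y\not\models a$ or $y\models b$, where $p^*:X\to Hom(A,\{0,1\})$ is given by $p^*(x)(c)=1$ iff $x\models c$. A morphism $(X,\models,A)\to(Y,\models',B)$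 in the category $\mathbf{I\text{-}TopSys}$ is a pair $(f_1,f_2)$ of a map $f_1:X\to Y$ and a Heyting homomorphism $f_2:B\to A$ with $x\models f_2(b)$ iff $f_1(x)\models' b$; composition is $(g_1,g_2)\circ(f_1,f_2)=(g_1\circ f_1,f_2\circ g_2)$. Consider the functors * $H:\mathbf{I\text{-}TopSys}\to\mathbf{HA}^{op}$, $H(X,\models,A)=A$, $H(f_1,f_2)=f_2$; * $S:\mathbf{HA}^{op}\to\mathbf{I\text{-}TopSys}$, $S(A)=(Hom(A,\{0,1\}),\models^*,A)$ with $v\models^*a$ iff $v(a)=1$, $S(f)=(\_\circ f,f)$; * $\mathrm{Spec}:\mathbf{HA}^{op}\to\mathbf{ESA}$, sending $A$ to $Hom(A,\{0,1\})$ with the pointwise order and the topology of pointwise convergence, and $f$ to $\_\circ f$; * $\mathrm{Clop}:\mathbf{ESA}\to\mathbf{HA}^{op}$, sending $Y$ to the Heyting algebra of its clopen up-sets, and $f$ to $f^{-1}$. **Theorem.** There is an adjunction between $\mathbf{I\text{-}TopSys}$ and $\mathbf{ESA}$: the functor $\mathrm{Spec}\circ H:\mathbf{I\text{-}TopSys}\to\mathbf{ESA}$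 is left adjoint to $S\circ\mathrm{Clop}:\mathbf{ESA}\to\mathbf{I\text{-}TopSys}$. This adjunction is the composite of an adjunction $H\dashv S$ and an adjunction $\mathrm{Spec}\dashv\mathrm{Clop}$, where $\mathrm{Spec}$ is an equivalence of categories (Esakia duality). -/

import Mathlib

open CategoryTheory Opposite

universe u

namespace ITop

/-! ### Homomorphisms into the two-element chain -/

/-- `Hom(A, {0,1})`: the bounded lattice homomorphisms from the Heyting algebra `A` to `{0,1}`. -/
def TwoHom (A : Type u) [HeytingAlgebra A] : Type u := BoundedLatticeHom A Bool

namespace TwoHom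

variable {A B : Type u} [HeytingAlgebra A] [HeytingAlgebra B]

instance : FunLike (TwoHom A) A Bool := inferInstanceAs (FunLike (BoundedLatticeHom A Bool) A Bool)

instance : BoundedLatticeHomClass (TwoHom A) A Bool :=
  inferInstanceAs (BoundedLatticeHomClass (BoundedLatticeHom A Bool) A Bool)

/-- The pointwise order: `v ≤ w` iff `v a ≤ w a` for all `a`. -/
instance : PartialOrder (TwoHom A) := PartialOrder.lift (fun v => (v : A → Bool)) DFunLike.coe_injective

/-- The topology of pointwise convergence; it has the sets `{v | v a = 1}` and `{v | v a = 0}`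
as a subbasis. -/
instance : TopologicalSpace (TwoHom A) :=
  TopologicalSpace.induced (fun v => (v : A → Bool)) inferInstance

theorem le_iff {v w : TwoHom A} : v ≤ w ↔ ∀ a, v a = true → w a = true := by
  change (∀ a, v a ≤ w a) ↔ _
  exact forall_congr' fun a => Bool.le_iff_imp

theorem eq_of_true_iff {v w : TwoHom A} (h : ∀ a, v a = true ↔ w a = true) : v = w :=
  DFunLike.ext _ _ fun a => Bool.eq_iff_iff.2 (h a)

theorem inf_true (v : TwoHom A) (a b : A) : v (a ⊓ b) = true ↔ v a = true ∧ v b = true := by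
  rw [map_inf]; cases v a <;> cases v b <;> decide

theorem sup_true (v : TwoHom A) (a b : A) : v (a ⊔ b) = true ↔ v a = true ∨ v b = true := by
  rw [map_sup]; cases v a <;> cases v b <;> decide

theorem bot_false (v : TwoHom A) : ¬ v ⊥ = true := by
  rw [map_bot]; decide

theorem top_true (v : TwoHom A) : v ⊤ = true := by
  rw [map_top]; rfl

theorem mono (v : TwoHom A) {a b : A} (h : a ≤ b) (ha : v a = true) : v b = true := by
  have := (v.sup_true a b).2 (Or.inl ha)
  rwa [sup_eq_right.2 h] at this

/-- Build a homomorphism into `{0,1}` from a predicate. -/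
noncomputable def ofPred (p : A → Prop) (hbot : ¬ p ⊥) (htop : p ⊤)
    (hinf : ∀ a b, p (a ⊓ b) ↔ p a ∧ p b) (hsup : ∀ a b, p (a ⊔ b) ↔ p a ∨ p b) : TwoHom A :=
  letI := Classical.decPred p
  show BoundedLatticeHom A Bool from
  { toFun := fun a => decide (p a)
    map_sup' := fun a b => by
      by_cases ha : p a <;> by_cases hb : p b <;> simp [hsup, ha, hb]
    map_inf' := fun a b => by
      by_cases ha : p a <;> by_cases hb : p b <;> simp [hinf, ha, hb]
    map_top' := by simp [htop]
    map_bot' := by simp [hbot] }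

theorem ofPred_true {p : A → Prop} {hbot htop hinf hsup} (a : A) :
    (ofPred p hbot htop hinf hsup : TwoHom A) a = true ↔ p a :=
  letI := Classical.decPred p
  decide_eq_true_iff

/-- Precomposition with a Heyting homomorphism. -/
noncomputable def comap (f : HeytingHom B A) (v : TwoHom A) : TwoHom B :=
  BoundedLatticeHom.comp (show BoundedLatticeHom A Bool from v) (f : BoundedLatticeHom B A)

@[simp] theorem comap_apply (f : HeytingHom B A) (v : TwoHom A) (b : B) :
    comap f v b = v (f b) := rfl

/-- Prime separation above `v`. -/
theorem exists_ge (v : TwoHom A) (P Q : Set A) (hP : P.Nonempty) (hQ : Q.Nonempty)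
    (hPi : ∀ a ∈ P, ∀ b ∈ P, a ⊓ b ∈ P) (hQs : ∀ a ∈ Q, ∀ b ∈ Q, a ⊔ b ∈ Q)
    (h : ∀ a ∈ P, ∀ b ∈ Q, ¬ v (a ⇨ b) = true) :
    ∃ w : TwoHom A, v ≤ w ∧ (∀ a ∈ P, w a = true) ∧ ∀ b ∈ Q, ¬ w b = true := by
  have hF : Order.IsPFilter {x : A | ∃ c, v c = true ∧ ∃ a ∈ P, c ⊓ a ≤ x} := by
    refine Order.IsPFilter.of_def ?_ ?_ ?_
    · obtain ⟨a, ha⟩ := hP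
      exact ⟨a, ⊤, v.top_true, a, ha, inf_le_right⟩
    · rintro x ⟨c, hc, a, ha, hx⟩ y ⟨d, hd, b, hb, hy⟩
      refine ⟨x ⊓ y, ⟨c ⊓ d, (v.inf_true c d).2 ⟨hc, hd⟩, a ⊓ b, hPi a ha b hb, ?_⟩,
        inf_le_left, inf_le_right⟩
      rw [inf_inf_inf_comm]
      exact inf_le_inf hx hy
    · rintro x y hxy ⟨c, hc, a, ha, hx⟩
      exact ⟨c, hc, a, ha, hx.trans hxy⟩
  have hI : Order.IsIdeal {x : A | ∃ b ∈ Q, x ≤ b} := by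
    refine ⟨?_, ?_, ?_⟩
    · rintro x y hyx ⟨b, hb, hx⟩
      exact ⟨b, hb, le_trans hyx hx⟩
    · obtain ⟨b, hb⟩ := hQ
      exact ⟨b, b, hb, le_rfl⟩
    · rintro x ⟨a, ha, hx⟩ y ⟨b, hb, hy⟩
      exact ⟨x ⊔ y, ⟨a ⊔ b, hQs a ha b hb, sup_le_sup hx hy⟩, le_sup_left, le_sup_right⟩
  have hFI : Disjoint (hF.toPFilter : Set A) (hI.toIdeal : Set A) := by
    rw [Set.disjoint_left]
    rintro x ⟨c, hc, a, ha, hx⟩ ⟨b, hb, hxb⟩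
    exact h a ha b hb (v.mono (le_himp_iff.2 (hx.trans hxb)) hc)
  obtain ⟨J, hJ, hIJ, hFJ⟩ := DistribLattice.prime_ideal_of_disjoint_filter_ideal hFI
  have hJ' := hJ.toIsProper
  rw [Set.disjoint_left] at hFJ
  refine ⟨ofPred (fun a => a ∉ J) (fun h => h J.bot_mem)
    (fun h => hJ'.ne_univ (Set.eq_univ_of_forall fun x => J.lower le_top h)) ?_ ?_, ?_, ?_, ?_⟩
  · intro a b
    constructor
    · exact fun h => ⟨fun ha => h (J.lower inf_le_left ha), fun hb => h (J.lower inf_le_right hb)⟩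
    · rintro ⟨ha, hb⟩ h
      exact (hJ.mem_or_mem h).elim ha hb
  · intro a b
    rw [Order.Ideal.sup_mem_iff, not_and_or]
  · refine le_iff.2 fun a ha => (ofPred_true a).2 (hFJ ?_)
    obtain ⟨p, hp⟩ := hP
    exact ⟨a, ha, p, hp, inf_le_left⟩
  · intro a ha
    exact (ofPred_true a).2 (hFJ ⟨⊤, v.top_true, a, ha, inf_le_right⟩)
  · intro b hb hw
    exact (ofPred_true b).1 hw (hIJ ⟨b, hb, le_rfl⟩)

theorem himp_true (v : TwoHom A) (a b : A) :
    v (a ⇨ b) = true ↔ ∀ w : TwoHom A, v ≤ w → w a = true → w b = true := by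
  constructor
  · intro h w hw ha
    have h1 := (w.inf_true _ _).2 ⟨le_iff.1 hw _ h, ha⟩
    exact w.mono himp_inf_le h1
  · intro h
    by_contra hv
    obtain ⟨w, hvw, ha, hb⟩ := v.exists_ge {a} {b} ⟨a, rfl⟩ ⟨b, rfl⟩
      (by rintro _ rfl _ rfl; exact inf_idem _) (by rintro _ rfl _ rfl; exact sup_idem _)
      (by rintro _ rfl _ rfl; exact hv)
    exact hb b rfl (h w hvw (ha a rfl))

theorem nonempty [Nontrivial A] : Nonempty (TwoHom A) := by
  have hd : Disjoint ((Order.PFilter.principal (⊤ : A) : Order.PFilter A) : Set A)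
      ((Order.Ideal.principal (⊥ : A) : Order.Ideal A) : Set A) := by
    rw [Set.disjoint_left]
    intro x hx hx'
    have h1 : (⊤ : A) ≤ x := hx
    have h2 : x ≤ (⊥ : A) := hx'
    exact top_ne_bot (le_antisymm (h1.trans h2) bot_le)
  obtain ⟨J, hJ, -, -⟩ := DistribLattice.prime_ideal_of_disjoint_filter_ideal hd
  have hJ' := hJ.toIsProper
  refine ⟨ofPred (fun a => a ∉ J) (fun h => h J.bot_mem)
    (fun h => hJ'.ne_univ (Set.eq_univ_of_forall fun x => J.lower le_top h)) ?_ ?_⟩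
  · intro a b
    constructor
    · exact fun h => ⟨fun ha => h (J.lower inf_le_left ha), fun hb => h (J.lower inf_le_right hb)⟩
    · rintro ⟨ha, hb⟩ h
      exact (hJ.mem_or_mem h).elim ha hb
  · intro a b
    rw [Order.Ideal.sup_mem_iff, not_and_or]

theorem continuous_coe : Continuous fun v : TwoHom A => (v : A → Bool) := continuous_induced_dom

theorem continuous_eval (a : A) : Continuous fun v : TwoHom A => v a :=
  (continuous_apply a).comp continuous_coe

theorem isClopen_true (a : A) : IsClopen {v : TwoHom A | v a = true} :=
  (isClopen_discrete {true}).preimage (continuous_eval a)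

instance : CompactSpace (TwoHom A) := by
  have hr : Set.range (fun v : TwoHom A => (v : A → Bool)) =
      {g | g ⊥ = false} ∩ {g | g ⊤ = true} ∩
      ((⋂ (a : A) (b : A), {g | g (a ⊓ b) = (g a && g b)}) ∩
        ⋂ (a : A) (b : A), {g | g (a ⊔ b) = (g a || g b)}) := by
    ext g
    simp only [Set.mem_range, Set.mem_inter_iff, Set.mem_iInter, Set.mem_ofPred_eq]
    constructor
    · rintro ⟨v, rfl⟩
      exact ⟨⟨map_bot v, map_top v⟩, map_inf v, map_sup v⟩
    · rintro ⟨⟨hb, ht⟩, hi, hs⟩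
      exact ⟨(show BoundedLatticeHom A Bool from
        { toFun := g, map_sup' := hs, map_inf' := hi, map_top' := ht, map_bot' := hb }), rfl⟩
  have hc : IsClosed (Set.range (fun v : TwoHom A => (v : A → Bool))) := by
    have hbool : ∀ (k : Bool × Bool → Bool) (a b : A),
        Continuous fun g : A → Bool => k (g a, g b) := fun k a b =>
      (continuous_of_discreteTopology (f := k)).comp
        ((continuous_apply a).prodMk (continuous_apply b))
    rw [hr]
    refine ((isClosed_eq (continuous_apply _) continuous_const).inter
      (isClosed_eq (continuous_apply _) continuous_const)).inter
      ((isClosed_iInter fun a => isClosed_iInter fun b => ?_).inter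
        (isClosed_iInter fun a => isClosed_iInter fun b => ?_))
    · exact isClosed_eq (continuous_apply _) (hbool (fun p => (p.1 && p.2)) a b)
    · exact isClosed_eq (continuous_apply _) (hbool (fun p => (p.1 || p.2)) a b)
  have he : Topology.IsClosedEmbedding (fun v : TwoHom A => (v : A → Bool)) :=
    ⟨⟨⟨rfl⟩, DFunLike.coe_injective⟩, hc⟩
  exact he.compactSpace

instance : PriestleySpace (TwoHom A) where
  priestley {v w} h := by
    rw [le_iff] at h
    push Not at h
    obtain ⟨a, hv, hw⟩ := h
    exact ⟨{u | u a = true}, isClopen_true a, fun x y hxy hx => le_iff.1 hxy a hx, hv, hw⟩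

theorem isClopen_basic (p : A × A) : IsClopen {v : TwoHom A | v p.1 = true ∧ ¬ v p.2 = true} :=
  (isClopen_true p.1).inter (isClopen_true p.2).compl

theorem isBasis : TopologicalSpace.IsTopologicalBasis
    (Set.range fun p : A × A => {v : TwoHom A | v p.1 = true ∧ ¬ v p.2 = true}) := by
  refine TopologicalSpace.isTopologicalBasis_of_isOpen_of_nhds ?_ ?_
  · rintro _ ⟨p, rfl⟩
    exact (isClopen_basic p).isOpen
  · intro v U hv hU
    obtain ⟨O, hO, rfl⟩ := isOpen_induced_iff.1 hU
    obtain ⟨I, t, ht, hs⟩ := isOpen_pi_iff.1 hO _ hv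
    classical
    refine ⟨_, ⟨((I.filter fun a => v a = true).inf id, (I.filter fun a => ¬ v a = true).sup id),
      rfl⟩, ⟨?_, ?_⟩, ?_⟩
    · have : ∀ s : Finset A, (∀ a ∈ s, v a = true) → v (s.inf id) = true := by
        intro s
        induction s using Finset.induction_on with
        | empty => intro _; exact v.top_true
        | insert a s ha ih =>
          intro h
          rw [Finset.inf_insert]
          exact (v.inf_true _ _).2 ⟨h a (by simp), ih fun b hb => h b (by simp [hb])⟩
      exact this _ fun a ha => (Finset.mem_filter.1 ha).2
    · have : ∀ s : Finset A, (∀ a ∈ s, ¬ v a = true) → ¬ v (s.sup id) = true := by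
        intro s
        induction s using Finset.induction_on with
        | empty => intro _; exact v.bot_false
        | insert a s ha ih =>
          intro h hh
          rw [Finset.sup_insert] at hh
          exact ((v.sup_true _ _).1 hh).elim (h a (by simp)) (ih fun b hb => h b (by simp [hb]))
      exact this _ fun a ha => (Finset.mem_filter.1 ha).2
    · rintro w ⟨h1, h2⟩
      refine hs fun a ha => ?_
      have : w a = v a := by
        rw [Bool.eq_iff_iff]
        constructor
        · intro hw
          by_contra hva
          exact h2 (w.mono (Finset.le_sup (f := id) (Finset.mem_filter.2 ⟨ha, hva⟩)) hw)
        · intro hva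
          exact w.mono (Finset.inf_le (f := id) (Finset.mem_filter.2 ⟨ha, hva⟩)) h1
      change w a ∈ t a
      rw [this]
      exact (ht a ha).2

theorem lowerClosure_basic (p : A × A) :
    (lowerClosure {v : TwoHom A | v p.1 = true ∧ ¬ v p.2 = true} : Set (TwoHom A)) =
      {v | v (p.1 ⇨ p.2) = true}ᶜ := by
  ext v
  simp only [SetLike.mem_coe, mem_lowerClosure, Set.mem_compl_iff, Set.mem_ofPred_eq, himp_true]
  push Not
  exact ⟨fun ⟨w, ⟨h1, h2⟩, h⟩ => ⟨w, h, h1, h2⟩, fun ⟨w, h, h1, h2⟩ => ⟨w, ⟨h1, h2⟩, h⟩⟩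

theorem isClopen_lowerClosure {U : Set (TwoHom A)} (hU : IsClopen U) :
    IsClopen (lowerClosure U : Set (TwoHom A)) := by
  obtain ⟨s, hs, rfl⟩ := (isCompact_open_iff_eq_finite_iUnion_of_isTopologicalBasis _ isBasis
    (fun p => (isClopen_basic p).isClosed.isCompact) U).1 ⟨hU.isClosed.isCompact, hU.isOpen⟩
  rw [lowerClosure_iUnion]
  simp only [lowerClosure_iUnion, LowerSet.coe_iSup]
  refine hs.isClopen_biUnion fun p _ => ?_
  rw [lowerClosure_basic]
  exact (isClopen_true _).compl

end TwoHom

/-! ### Esakia spaces -/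

/-- An Esakia space: a compact partially ordered space, in which points `x ≰ y` are separated by
clopen up-sets, and in which the down-set of a clopen set is clopen. -/
class EsakiaSpace (X : Type u) [PartialOrder X] [TopologicalSpace X] : Prop
    extends CompactSpace X, PriestleySpace X where
  isClopen_lowerClosure : ∀ U : Set X, IsClopen U → IsClopen (lowerClosure U : Set X)

instance {A : Type u} [HeytingAlgebra A] : EsakiaSpace (TwoHom A) where
  isClopen_lowerClosure _ hU := TwoHom.isClopen_lowerClosure hU

/-- Bundled Esakia spaces. -/
structure Esa : Type (u + 1) where
  carrier : Type u
  [order : PartialOrder carrier]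
  [top : TopologicalSpace carrier]
  [esakia : EsakiaSpace carrier]

attribute [instance] Esa.order Esa.top Esa.esakia

/-- Esakia spaces and Esakia morphisms (continuous monotone maps with the back condition). -/
instance : Category Esa.{u} where
  Hom X Y := EsakiaHom X.carrier Y.carrier
  id X := EsakiaHom.id X.carrier
  comp f g := EsakiaHom.comp g f

/-- The category **ESA** of (nonempty) Esakia spaces. -/
abbrev ESA : Type (u + 1) := ObjectProperty.FullSubcategory fun X : Esa.{u} => Nonempty X.carrier

/-- The category **HA** of (nontrivial) Heyting algebras and Heyting homomorphisms. -/
abbrev HA : Type (u + 1) := ObjectProperty.FullSubcategory fun A : HeytAlg.{u} => Nontrivial A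

/-! ### The Heyting algebra of clopen up-sets -/

section ClopenUp

variable {X Y : Type u} [PartialOrder X] [TopologicalSpace X] [EsakiaSpace X]
  [PartialOrder Y] [TopologicalSpace Y] [EsakiaSpace Y]

/-- `U ⇨ V` is the complement of the down-set of `U \ V`. -/
def clopenHimp (U V : ClopenUpperSet X) : ClopenUpperSet X where
  carrier := (lowerClosure ((U : Set X) \ V) : Set X)ᶜ
  isClopen' := (EsakiaSpace.isClopen_lowerClosure _ (U.isClopen.diff V.isClopen)).compl
  upper' := (lowerClosure ((U : Set X) \ V)).lower.compl

theorem mem_clopenHimp {U V : ClopenUpperSet X} {x : X} :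
    x ∈ clopenHimp U V ↔ ∀ y, x ≤ y → y ∈ U → y ∈ V := by
  change ¬ (x ∈ lowerClosure ((U : Set X) \ V)) ↔ _
  rw [mem_lowerClosure]
  push Not
  exact ⟨fun h y hxy hU => by_contra fun hV => h y ⟨hU, hV⟩ hxy,
    fun h y hy hxy => hy.2 (h y hxy hy.1)⟩

/-- The Heyting algebra of clopen up-sets of an Esakia space, ordered by inclusion. -/
instance : HeytingAlgebra (ClopenUpperSet X) :=
  { (inferInstance : Lattice (ClopenUpperSet X)),
    (inferInstance : BoundedOrder (ClopenUpperSet X)) with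
    himp := clopenHimp
    compl := fun U => clopenHimp U ⊥
    le_himp_iff := fun W U V => by
      constructor
      · rintro h x ⟨hW, hU⟩
        exact mem_clopenHimp.1 (h hW) x le_rfl hU
      · intro h x hx
        exact mem_clopenHimp.2 fun y hxy hU => h ⟨W.upper hxy hx, hU⟩
    himp_bot := fun _ => rfl }

/-- The inverse image map of an Esakia morphism. -/
def clopenComap (f : EsakiaHom X Y) : HeytingHom (ClopenUpperSet Y) (ClopenUpperSet X) where
  toFun U :=
    { carrier := f ⁻¹' U
      isClopen' := U.isClopen.preimage (map_continuous f)
      upper' := fun _ _ hxy hx => U.upper (OrderHomClass.mono f hxy) hx }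
  map_sup' _ _ := rfl
  map_inf' _ _ := rfl
  map_bot' := rfl
  map_himp' U V := by
    refine SetLike.ext fun x => ?_
    change f x ∈ clopenHimp U V ↔ x ∈ clopenHimp _ _
    rw [mem_clopenHimp, mem_clopenHimp]
    constructor
    · exact fun h y hxy hy => h (f y) (OrderHomClass.mono f hxy) hy
    · intro h z hz hU
      obtain ⟨y, hxy, rfl⟩ := EsakiaHomClass.exists_map_eq_of_map_le f hz
      exact h y hxy hU

end ClopenUp

/-! ### The functors of Esakia duality -/

/-- Precomposition with a Heyting homomorphism, as an Esakia morphism. -/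
noncomputable def specMap {A B : Type u} [HeytingAlgebra A] [HeytingAlgebra B] (f : HeytingHom B A) :
    EsakiaHom (TwoHom A) (TwoHom B) where
  toFun := TwoHom.comap f
  monotone' v w h := fun b => h (f b)
  continuous_toFun := continuous_induced_rng.2
    (continuous_pi fun b => TwoHom.continuous_eval (f b))
  exists_map_eq_of_map_le' v w h := by
    replace h := TwoHom.le_iff.1 h
    obtain ⟨z, hvz, h1, h2⟩ := v.exists_ge (f '' {b | w b = true}) (f '' {b | ¬ w b = true})
      ⟨_, ⊤, w.top_true, rfl⟩ ⟨_, ⊥, w.bot_false, rfl⟩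
      (by
        rintro _ ⟨a, ha, rfl⟩ _ ⟨b, hb, rfl⟩
        exact ⟨a ⊓ b, (w.inf_true a b).2 ⟨ha, hb⟩, map_inf f a b⟩)
      (by
        rintro _ ⟨a, ha, rfl⟩ _ ⟨b, hb, rfl⟩
        exact ⟨a ⊔ b, fun hab => ((w.sup_true a b).1 hab).elim ha hb, map_sup f a b⟩)
      (by
        rintro _ ⟨a, ha, rfl⟩ _ ⟨b, hb, rfl⟩ hv
        rw [← map_himp] at hv
        exact hb ((w.himp_true a b).1 (h _ hv) w le_rfl ha))
    refine ⟨z, hvz, TwoHom.eq_of_true_iff fun b => ⟨fun hz => ?_, fun hw => h1 _ ⟨b, hw, rfl⟩⟩⟩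
    by_contra hw
    exact h2 _ ⟨b, hw, rfl⟩ hz

/-- `A ↦ Hom(A, {0,1})`, `f ↦ _ ∘ f`. -/
noncomputable def specFunctor : HeytAlg.{u}ᵒᵖ ⥤ Esa.{u} where
  obj A := { carrier := TwoHom A.unop }
  map f := specMap f.unop.hom
  map_id _ := rfl
  map_comp _ _ := rfl

/-- `Y ↦` clopen up-sets of `Y`, `f ↦ f⁻¹`. -/
def clopFunctor : Esa.{u} ⥤ HeytAlg.{u}ᵒᵖ where
  obj Y := op (HeytAlg.of (ClopenUpperSet Y.carrier))
  map f := (HeytAlg.ofHom (clopenComap f)).op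
  map_id _ := rfl
  map_comp _ _ := rfl

/-- The functor **HA**ᵒᵖ → **ESA** of Esakia duality, `A ↦ Hom(A, {0,1})`. -/
noncomputable def Spec : HA.{u}ᵒᵖ ⥤ ESA.{u} :=
  ObjectProperty.lift _ ((ObjectProperty.ι _).op ⋙ specFunctor) fun A =>
    haveI : Nontrivial A.unop.obj := A.unop.property
    TwoHom.nonempty (A := A.unop.obj)

/-- The functor **ESA** → **HA**ᵒᵖ of Esakia duality, sending a space to its Heyting algebra of
clopen up-sets. -/
def Clop : ESA.{u} ⥤ HA.{u}ᵒᵖ where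
  obj Y := op ⟨(clopFunctor.obj Y.obj).unop, by
    obtain ⟨y⟩ := Y.property
    refine ⟨⟨(⊥ : ClopenUpperSet Y.obj.carrier), (⊤ : ClopenUpperSet Y.obj.carrier), fun h => ?_⟩⟩
    have : y ∈ (⊤ : ClopenUpperSet Y.obj.carrier) := trivial
    rw [← h] at this
    exact this⟩
  map f := (ObjectProperty.homMk (clopFunctor.map f.hom).unop).op
  map_id _ := rfl
  map_comp _ _ := rfl

/-! ### I-topological systems -/

/-- I-topological systems `(X, ⊨, A)`. In the last clause the condition
`∀ c, x ⊨ c → y ⊨ c` says `p*(x) ≤ p*(y)` for the map `p* : X → Hom(A, {0,1})` given by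
`p*(x)(c) = 1 ↔ x ⊨ c` (see `ITopSys.pStar` and `ITopSys.pStar_le`). -/
structure ITopSys : Type (u + 1) where
  X : Type u
  [nonempty : Nonempty X]
  A : HeytAlg.{u}
  sat : X → A → Prop
  sat_bot : ∀ x, ¬ sat x ⊥
  sat_inf : ∀ x a b, sat x (a ⊓ b) ↔ sat x a ∧ sat x b
  sat_sup : ∀ x a b, sat x (a ⊔ b) ↔ sat x a ∨ sat x b
  sat_himp : ∀ x a b, sat x (a ⇨ b) ↔ ∀ y, (∀ c, sat x c → sat y c) → ¬ sat y a ∨ sat y b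

namespace ITopSys

theorem sat_top (T : ITopSys.{u}) (x : T.X) : T.sat x ⊤ := by
  rw [← himp_self (a := (⊥ : T.A)), T.sat_himp]
  exact fun y _ => Or.inl (T.sat_bot y)

/-- The map `p* : X → Hom(A, {0,1})`. -/
noncomputable def pStar (T : ITopSys.{u}) (x : T.X) : TwoHom T.A :=
  TwoHom.ofPred (T.sat x) (T.sat_bot x) (T.sat_top x) (T.sat_inf x) (T.sat_sup x)

theorem pStar_true (T : ITopSys.{u}) (x : T.X) (a : T.A) : T.pStar x a = true ↔ T.sat x a :=
  TwoHom.ofPred_true a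

theorem pStar_le (T : ITopSys.{u}) (x y : T.X) :
    T.pStar x ≤ T.pStar y ↔ ∀ c, T.sat x c → T.sat y c := by
  simp only [TwoHom.le_iff, pStar_true]

/-- Continuous maps `(f₁, f₂)` of I-topological systems. -/
@[ext]
structure Hom (S T : ITopSys.{u}) : Type u where
  map : S.X → T.X
  alg : T.A ⟶ S.A
  cont : ∀ (x : S.X) (b : T.A), S.sat x (alg b) ↔ T.sat (map x) b

/-- The category **I-TopSys**. -/
instance : Category ITopSys.{u} where
  Hom := Hom
  id T := { map := id, alg := 𝟙 T.A, cont := fun _ _ => Iff.rfl }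
  comp f g :=
    { map := g.map ∘ f.map
      alg := g.alg ≫ f.alg
      cont := fun x c => (f.cont x (g.alg c)).trans (g.cont (f.map x) c) }

theorem nontrivial (T : ITopSys.{u}) : Nontrivial T.A := by
  obtain ⟨x⟩ := T.nonempty
  exact ⟨⟨⊥, ⊤, fun h => T.sat_bot x (h ▸ T.sat_top x)⟩⟩

end ITopSys

/-- The functor `H : I-TopSys → HAᵒᵖ`, `(X, ⊨, A) ↦ A`, `(f₁, f₂) ↦ f₂`. -/
def H : ITopSys.{u} ⥤ HA.{u}ᵒᵖ where
  obj T := op ⟨T.A, T.nontrivial⟩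
  map f := (ObjectProperty.homMk f.alg).op
  map_id _ := rfl
  map_comp _ _ := rfl

/-- The functor `S : HAᵒᵖ → I-TopSys`, `A ↦ (Hom(A, {0,1}), ⊨*, A)` with `v ⊨* a ↔ v a = 1`,
`f ↦ (_ ∘ f, f)`. -/
noncomputable def S : HA.{u}ᵒᵖ ⥤ ITopSys.{u} where
  obj A :=
    { X := TwoHom A.unop.obj
      nonempty :=
        haveI : Nontrivial A.unop.obj := A.unop.property
        TwoHom.nonempty
      A := A.unop.obj
      sat := fun v a => v a = true
      sat_bot := TwoHom.bot_false
      sat_inf := TwoHom.inf_true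
      sat_sup := TwoHom.sup_true
      sat_himp := fun v a b => by
        simp only [TwoHom.himp_true, TwoHom.le_iff, imp_iff_not_or] }
  map f :=
    { map := TwoHom.comap f.unop.hom.hom
      alg := f.unop.hom
      cont := fun _ _ => Iff.rfl }
  map_id _ := rfl
  map_comp _ _ := rfl

end ITop

/-! For `H ⊣ S`: in a morphism from `(X, ⊨, A)` to `S(B)` the algebra part `f₂ : B → A` determines
the point part, since `x ⊨ f₂(b)` iff `f₁(x)(b) = 1` forces `f₁(x) = p*(x) ∘ f₂`. So such morphisms
are just Heyting homomorphisms `B → A`; the unit is `(p*, id)` and the counit is the identity.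

For Esakia duality, `a ↦ {v | v a = 1}` and `y ↦ {U | y ∈ U}` are order isomorphisms. The first
reflects order by the prime ideal theorem, the second by Priestley separation; both are onto by
compactness. An equivalence is in particular an adjunction, and composing the two adjunctions gives
the result. -/

namespace ITop

/-! ### Heyting algebras as clopen up-sets of their spectra -/

namespace TwoHom

variable {A : Type u} [HeytingAlgebra A]

theorem finsetInf_true (v : TwoHom A) {ι : Type*} (s : Finset ι) (f : ι → A) :
    v (s.inf f) = true ↔ ∀ i ∈ s, v (f i) = true := by
  classical
  induction s using Finset.induction_on with
  | empty => simp
  | insert i s _ ih => simp only [Finset.inf_insert, inf_true, ih, Finset.forall_mem_insert]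

theorem finsetSup_true (v : TwoHom A) {ι : Type*} (s : Finset ι) (f : ι → A) :
    v (s.sup f) = true ↔ ∃ i ∈ s, v (f i) = true := by
  classical
  induction s using Finset.induction_on with
  | empty => simp
  | insert i s _ ih => simp only [Finset.sup_insert, sup_true, ih, Finset.exists_mem_insert]

/-- Elements of a Heyting algebra are separated by homomorphisms into `{0,1}`. -/
theorem exists_true_not_true {a b : A} (h : ¬ a ≤ b) :
    ∃ v : TwoHom A, v a = true ∧ ¬ v b = true := by
  have hd : Disjoint ((Order.PFilter.principal a : Order.PFilter A) : Set A)
      ((Order.Ideal.principal b : Order.Ideal A) : Set A) := by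
    rw [Set.disjoint_left]
    intro x hx hx'
    have h1 : a ≤ x := hx
    have h2 : x ≤ b := hx'
    exact h (h1.trans h2)
  obtain ⟨J, hJ, hbJ, haJ⟩ := DistribLattice.prime_ideal_of_disjoint_filter_ideal hd
  have hJ' := hJ.toIsProper
  -- The homomorphism is the indicator of the complement of a prime ideal that contains `b` and
  -- misses the principal filter of `a`.
  refine ⟨ofPred (fun a => a ∉ J) (fun h => h J.bot_mem)
    (fun h => hJ'.ne_univ (Set.eq_univ_of_forall fun x => J.lower le_top h)) ?_ ?_,
    (ofPred_true a).2 ?_, fun h => (ofPred_true b).1 h ?_⟩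
  · exact fun a b => ⟨fun h => ⟨fun ha => h (J.lower inf_le_left ha),
      fun hb => h (J.lower inf_le_right hb)⟩, fun ⟨ha, hb⟩ h => (hJ.mem_or_mem h).elim ha hb⟩
  · intro a b
    rw [Order.Ideal.sup_mem_iff, not_and_or]
  · exact Set.disjoint_left.1 haJ (show a ≤ a from le_rfl)
  · exact hbJ (show b ≤ b from le_rfl)

/-- The clopen up-set of homomorphisms taking the value `1` at `a`. -/
def trueSet (a : A) : ClopenUpperSet (TwoHom A) where
  carrier := {v | v a = true}
  isClopen' := isClopen_true a
  upper' _ _ hvw hv := le_iff.1 hvw a hv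

theorem mem_trueSet {a : A} {v : TwoHom A} : v ∈ trueSet a ↔ v a = true := Iff.rfl

theorem trueSet_le_trueSet {a b : A} : trueSet a ≤ trueSet b ↔ a ≤ b := by
  refine ⟨fun h => by_contra fun hab => ?_, fun h v hv => v.mono h hv⟩
  obtain ⟨v, ha, hb⟩ := exists_true_not_true hab
  exact hb (h (show v ∈ trueSet a from ha))

/-- Two compactness arguments: a clopen up-set is a union of sets `trueSet a` contained in it, and
finitely many suffice, so their join represents it. -/
theorem trueSet_surjective : Function.Surjective (trueSet : A → ClopenUpperSet (TwoHom A)) := by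
  intro U
  -- Every `w ∉ U` satisfies `¬ v ≤ w`, so some `a` is true at `v` and false at `w`. Compactness of
  -- the complement of `U` leaves finitely many such `a`; their meet works.
  have key : ∀ v ∈ U, ∃ a : A, v a = true ∧ ∀ w : TwoHom A, w a = true → w ∈ U := by
    intro v hv
    obtain ⟨t, ht⟩ := U.isClopen.compl.isClosed.isCompact.elim_finite_subcover
      (fun a : {a : A // v a = true} => {w : TwoHom A | ¬ w a.1 = true})
      (fun a => (isClopen_true a.1).compl.isOpen) (fun w hw => by
        have hvw : ¬ v ≤ w := fun h => hw (U.upper h hv)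
        rw [le_iff] at hvw
        push Not at hvw
        obtain ⟨a, ha, hwa⟩ := hvw
        exact Set.mem_iUnion.2 ⟨⟨a, ha⟩, by simpa using hwa⟩)
    refine ⟨t.inf Subtype.val, (v.finsetInf_true _ _).2 fun a _ => a.2, fun w hw => ?_⟩
    by_contra hwU
    obtain ⟨a, ha, hwa⟩ := Set.mem_iUnion₂.1 (ht hwU)
    exact hwa ((w.finsetInf_true _ _).1 hw a ha)
  obtain ⟨t, ht⟩ := U.isClopen.isClosed.isCompact.elim_finite_subcover
    (fun a : {a : A // ∀ w : TwoHom A, w a = true → w ∈ U} => {w : TwoHom A | w a.1 = true})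
    (fun a => (isClopen_true a.1).isOpen) (fun v hv => by
      obtain ⟨a, hva, ha⟩ := key v hv
      exact Set.mem_iUnion.2 ⟨⟨a, ha⟩, hva⟩)
  refine ⟨t.sup Subtype.val, SetLike.ext fun v => ?_⟩
  rw [mem_trueSet, finsetSup_true]
  constructor
  · rintro ⟨a, -, ha⟩
    exact a.2 v ha
  · intro hv
    obtain ⟨a, ha, hva⟩ := Set.mem_iUnion₂.1 (ht hv)
    exact ⟨a, ha, hva⟩

variable (A) in
/-- A Heyting algebra is isomorphic to the clopen up-sets of its space of homomorphisms into
`{0,1}`. -/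
noncomputable def trueSetIso : A ≃o ClopenUpperSet (TwoHom A) where
  toEquiv := Equiv.ofBijective trueSet ⟨fun _ _ h =>
    le_antisymm (trueSet_le_trueSet.1 h.le) (trueSet_le_trueSet.1 h.ge), trueSet_surjective⟩
  map_rel_iff' := trueSet_le_trueSet

end TwoHom

/-! ### Esakia spaces as spectra of their clopen up-sets -/

section Point

variable {Y : Type u} [PartialOrder Y] [TopologicalSpace Y] [EsakiaSpace Y]

/-- The homomorphism into `{0,1}` given by membership of a point in clopen up-sets. -/
noncomputable def pointHom (y : Y) : TwoHom (ClopenUpperSet Y) :=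
  TwoHom.ofPred (fun U => y ∈ U) (fun h => h) trivial (fun _ _ => Iff.rfl) (fun _ _ => Iff.rfl)

theorem pointHom_true {y : Y} {U : ClopenUpperSet Y} : pointHom y U = true ↔ y ∈ U :=
  TwoHom.ofPred_true U

theorem pointHom_le_pointHom {x y : Y} : pointHom x ≤ pointHom y ↔ x ≤ y := by
  simp only [TwoHom.le_iff, pointHom_true]
  refine ⟨fun h => by_contra fun hxy => ?_, fun h U hx => U.upper h hx⟩
  obtain ⟨U, hU, hU', hx, hy⟩ := exists_isClopen_upper_of_not_le hxy
  exact hy (h ⟨⟨U, hU⟩, hU'⟩ hx)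

theorem isClopen_pointHom_eq (v : TwoHom (ClopenUpperSet Y)) (U : ClopenUpperSet Y) :
    IsClopen {y | pointHom y U = v U} := by
  cases h : v U
  · convert U.isClopen.compl using 1
    ext y
    rw [Set.mem_ofPred_eq, ← Bool.not_eq_true, pointHom_true]
    rfl
  · convert U.isClopen using 1
    ext y
    exact pointHom_true

/-- If no point realises `v`, the closed conditions `pointHom y U = v U` have empty intersection, so
by compactness finitely many of them are already inconsistent. This contradicts that `v` preserves
finite meets and joins. -/
theorem pointHom_surjective :
    Function.Surjective (pointHom : Y → TwoHom (ClopenUpperSet Y)) := by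
  classical
  intro v
  by_contra hv
  obtain ⟨t, ht⟩ := isCompact_univ.elim_finite_subfamily_closed
    (fun U : ClopenUpperSet Y => {y | pointHom y U = v U})
    (fun U => (isClopen_pointHom_eq v U).isClosed) (by
      rw [Set.univ_inter, Set.eq_empty_iff_forall_notMem]
      exact fun y hy => hv ⟨y, DFunLike.ext _ _ (Set.mem_iInter.1 hy)⟩)
  -- A point in every listed `U` with `v U = 1` and in none with `v U = 0` would meet all the
  -- conditions in `t`; hence the meet of the former lies below the join of the latter.
  have hle : (t.filter fun U => v U = true).inf id ≤ (t.filter fun U => ¬ v U = true).sup id := by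
    intro y hy
    have hy' := (TwoHom.finsetInf_true _ _ _).1 (pointHom_true.2 hy)
    refine pointHom_true.1 ((TwoHom.finsetSup_true _ _ _).2 ?_)
    by_contra! h
    refine (Set.eq_empty_iff_forall_notMem.1 ht y) ⟨trivial, Set.mem_iInter₂.2 fun U hU => ?_⟩
    by_cases hvU : v U = true
    · exact (hy' U (Finset.mem_filter.2 ⟨hU, hvU⟩)).trans hvU.symm
    · have hyU := h U (Finset.mem_filter.2 ⟨hU, hvU⟩)
      exact (Bool.eq_false_of_not_eq_true hyU).trans (Bool.eq_false_of_not_eq_true hvU).symm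
  obtain ⟨U, hU, hvU⟩ := (v.finsetSup_true _ _).1 (v.mono hle ((v.finsetInf_true _ _).2
    fun U hU => (Finset.mem_filter.1 hU).2))
  exact (Finset.mem_filter.1 hU).2 hvU

theorem continuous_pointHom : Continuous (pointHom : Y → TwoHom (ClopenUpperSet Y)) := by
  refine continuous_induced_rng.2 (continuous_pi fun U => continuous_discrete_rng.2 fun b => ?_)
  cases b
  · convert U.isClopen.compl.isOpen using 1
    ext y
    change pointHom y U = false ↔ _
    rw [← Bool.not_eq_true, pointHom_true]
    rfl
  · convert U.isClopen.isOpen using 1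
    ext y
    exact pointHom_true

variable (Y) in
/-- An Esakia space is order isomorphic to the homomorphisms from its clopen up-sets into
`{0,1}`. -/
noncomputable def pointHomIso : Y ≃o TwoHom (ClopenUpperSet Y) where
  toEquiv := Equiv.ofBijective pointHom ⟨fun _ _ h =>
    le_antisymm (pointHom_le_pointHom.1 h.le) (pointHom_le_pointHom.1 h.ge), pointHom_surjective⟩
  map_rel_iff' := pointHom_le_pointHom

end Point

/-! ### Esakia duality as an equivalence -/

/-- A continuous order isomorphism is an Esakia morphism. -/
def esakiaHomOfOrderIso {X Y : Type u} [PartialOrder X] [TopologicalSpace X] [PartialOrder Y]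
    [TopologicalSpace Y] (e : X ≃o Y) (he : Continuous e) : EsakiaHom X Y where
  toFun := e
  monotone' := e.monotone
  continuous_toFun := he
  exists_map_eq_of_map_le' _ b h := ⟨e.symm b, e.le_symm_apply.2 h, e.apply_symm_apply b⟩

/-- A continuous order isomorphism of Esakia spaces is an isomorphism in `Esa`. -/
def esaIsoMk {X Y : Esa.{u}} (e : X.carrier ≃o Y.carrier) (he : Continuous e) : X ≅ Y where
  hom := esakiaHomOfOrderIso e he
  -- The inverse is continuous because a continuous bijection from a compact space to a Hausdorff
  -- space is a homeomorphism.
  inv := esakiaHomOfOrderIso e.symm (he.continuous_symm_of_equiv_compact_to_t2 (f := e.toEquiv))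
  hom_inv_id := EsakiaHom.ext e.symm_apply_apply
  inv_hom_id := EsakiaHom.ext e.apply_symm_apply

/-- The unit of Esakia duality. -/
noncomputable def esakiaUnitIso : 𝟭 HA.{u}ᵒᵖ ≅ Spec ⋙ Clop :=
  -- Passing to the opposite category reverses `trueSetIso`, hence the final `symm`.
  (NatIso.ofComponents
    (fun A => (ObjectProperty.isoMk _ (X := A.unop) (Y := (Clop.obj (Spec.obj A)).unop)
      (HeytAlg.Iso.mk (TwoHom.trueSetIso A.unop.obj))).op)
    (fun _ => rfl)).symm

/-- The counit of Esakia duality. -/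
noncomputable def esakiaCounitIso : Clop ⋙ Spec ≅ 𝟭 ESA.{u} :=
  (NatIso.ofComponents
    (fun Y => ObjectProperty.isoMk _ (X := Y) (Y := Spec.obj (Clop.obj Y))
      (esaIsoMk (Y := (Spec.obj (Clop.obj Y)).obj) (pointHomIso Y.obj.carrier)
        continuous_pointHom))
    (fun _ => rfl)).symm

/-- Esakia duality. -/
noncomputable def esakiaEquivalence : HA.{u}ᵒᵖ ≌ ESA.{u} :=
  -- `Equivalence.mk` adjusts the unit so that the triangle identities hold; they need no separate
  -- check.
  CategoryTheory.Equivalence.mk Spec Clop esakiaUnitIso esakiaCounitIso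

/-! ### The adjunction `H ⊣ S` -/

/-- The unit of `H ⊣ S`: the morphism `(p*, id)`. -/
noncomputable def pStarHom (T : ITopSys.{u}) : T ⟶ S.obj (H.obj T) :=
  ITopSys.Hom.mk T.pStar (𝟙 T.A) fun x b => (T.pStar_true x b).symm

/-- Naturality of the unit on points; it is the continuity condition on `f` read through `p*`. -/
theorem pStar_map {T T' : ITopSys.{u}} (f : T ⟶ T') (x : T.X) :
    T'.pStar (f.map x) = TwoHom.comap f.alg.hom (T.pStar x) :=
  TwoHom.eq_of_true_iff fun b =>
    (T'.pStar_true _ b).trans ((f.cont x b).symm.trans (T.pStar_true x _).symm)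

/-- The point part of the right triangle identity for `H ⊣ S`. -/
theorem pStar_S (A : HA.{u}ᵒᵖ) (v : (S.obj A).X) : (S.obj A).pStar v = v :=
  TwoHom.eq_of_true_iff fun a => (S.obj A).pStar_true v a

/-- The functor `H` is left adjoint to `S`. -/
noncomputable def adjunctionHS : H.{u} ⊣ S.{u} :=
  Adjunction.mkOfUnitCounit
    { unit :=
        { app := pStarHom
          naturality := fun _ _ f => ITopSys.Hom.ext (funext (pStar_map f)) rfl }
      counit :=
        { app := fun A => 𝟙 A
          naturality := fun _ _ _ => rfl }
      left_triangle := rfl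
      right_triangle := by
        ext A
        exact ITopSys.Hom.ext (funext (pStar_S A)) rfl }

end ITop

theorem mainTheorem5 :
    ∃ (α : ITop.H.{u} ⊣ ITop.S.{u}) (ε : ITop.Spec.{u} ⊣ ITop.Clop.{u})
      (adj : (ITop.H.{u} ⋙ ITop.Spec.{u}) ⊣ (ITop.Clop.{u} ⋙ ITop.S.{u})),
      ITop.Spec.{u}.IsEquivalence ∧ adj = α.comp ε :=
  ⟨ITop.adjunctionHS, ITop.esakiaEquivalence.toAdjunction, _,
    ITop.esakiaEquivalence.isEquivalence_functor, rfl⟩
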